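/- For a topological space $X$, a \emph{covering map} $p:E\to X$ is a continuous map such that every point of $X$ has an open neighborhood $U$ with $p^{-1}(U)$ homeomorphic over $U$ to $U\times F$ for some discrete space $F$; fibers may be empty. $\mathrm{Cov}(X)$ is the category of covering maps $p:E\to X$, whose morphisms $p_1\to p_2$ are the continuous maps $t:E_1\to E_2$ with $p_2\circ t=p_1$. $\mathrm{SCov}(X)$ has as objects the surjective covering maps and as morphisms the surjective such $t$. For $x_0\in X$, $\mathrm{BCov}(X,x_0)$ has as objects the based covering maps $p:(E,e_0)\to(X,x_0)$ and as morphisms the basepoint-preserving such $t$; $\mathrm{BSCov}(X,x_0)$ has as objects the based surjective covering maps and as morphisms the surjective basepoint-preserving such $t$. A continuous map $f:X\to Y$ (with $f(x_0)=y_0$ in the based cases) induces a pullback functor $f^*$ from each of the categories $\mathrm{Cov}(Y)$, $\mathrm{SCov}(Y)$, $\mathrm{BCov}(Y,y_0)$, $\mathrm{BSCov}(Y,y_0)$ to the corresponding category for $X$ (resp. $(X,x_0)$): it sends $p:E\to Y$ to the projection to $X$ of $f^*(E)=\{(x,e)\in X\times E : f(x)=p(e)\}$ (based at $(x_0,e_0)$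 in the based cases), and $t$ to $(x,e)\mapsto(x,t(e))$. \textbf{Proposition.} Fix any one of these four kinds of categories of coverings. Let $X$ and $Y$ be locally path-connected and semilocally simply-connected spaces (the latter meaning that every point $x$ has an open neighborhood $U$ for which the inclusion-induced homomorphism $\pi_1(U,x)\to\pi_1(X,x)$ is trivial), not necessarily connected, and let $f:X\to Y$ be a continuous map (a based map $(X,x_0)\to(Y,y_0)$ in the two based cases). Then $f^*$ is an equivalence of categories if and only if the induced function $f_*:\pi_0(X)\to\pi_0(Y)$ on path components is a bijection and the induced homomorphism $\pi_1(X,x)\to\pi_1(Y,f(x))$ is an isomorphism for each $x\in X$. -/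

import Mathlib

open CategoryTheory Topology

universe u

/-- A space is semilocally simply-connected if every point `x` has an open neighborhood `U` such
that the homomorphism `π₁(U, x) → π₁(X, x)` induced by inclusion is trivial. -/
def SemilocallySimplyConnected (X : Type u) [TopologicalSpace X] : Prop :=
  ∀ x : X, ∃ U : Set X, IsOpen U ∧ ∃ hx : x ∈ U,
    ∀ γ : FundamentalGroup U ⟨x, hx⟩,
      FundamentalGroup.map (⟨Subtype.val, continuous_subtype_val⟩ : C(U, X)) ⟨x, hx⟩ γ = 1

/-- The function on sets of path components `π₀(X) → π₀(Y)` induced by a map `f`. -/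
def pi0Map {X Y : Type u} [TopologicalSpace X] [TopologicalSpace Y] (f : C(X, Y)) :
    ZerothHomotopy X → ZerothHomotopy Y :=
  Quotient.map f fun _ _ h => Joined.map h f.continuous

/-! ### The four categories of coverings -/

/-- The objects of `Cov(X)`: covering maps `p : E → X` (empty fibers are permitted). -/
structure Cov (X : Type u) [TopologicalSpace X] where
  /-- the total space -/
  E : Type u
  [top : TopologicalSpace E]
  /-- the projection -/
  p : E → X
  isCoveringMap : IsCoveringMap p

attribute [instance] Cov.top

/-- Morphisms of coverings: continuous maps of total spaces over the base. -/
@[ext]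
structure Cov.Hom {X : Type u} [TopologicalSpace X] (A B : Cov X) where
  /-- the map of total spaces -/
  map : C(A.E, B.E)
  comm : ∀ e, B.p (map e) = A.p e

instance Cov.category (X : Type u) [TopologicalSpace X] : Category.{u} (Cov X) where
  Hom A B := Cov.Hom A B
  id A := ⟨ContinuousMap.id A.E, fun _ => rfl⟩
  comp s t := ⟨t.map.comp s.map, fun e => (t.comm (s.map e)).trans (s.comm e)⟩

/-- The objects of `SCov(X)`: surjective covering maps. -/
structure SCov (X : Type u) [TopologicalSpace X] extends Cov X where
  surj : Function.Surjective p

/-- Morphisms of `SCov(X)`: surjective morphisms of coverings. -/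
@[ext]
structure SCov.Hom {X : Type u} [TopologicalSpace X] (A B : SCov X) extends
    Cov.Hom A.toCov B.toCov where
  surj : Function.Surjective map

instance SCov.category (X : Type u) [TopologicalSpace X] : Category.{u} (SCov X) where
  Hom A B := SCov.Hom A B
  id A := ⟨⟨ContinuousMap.id A.E, fun _ => rfl⟩, Function.surjective_id⟩
  comp s t := ⟨⟨t.map.comp s.map, fun e => (t.comm (s.map e)).trans (s.comm e)⟩,
    t.surj.comp s.surj⟩

/-- The objects of `BCov(X, x₀)`: based covering maps `p : (E, e₀) → (X, x₀)`. -/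
structure BCov (X : Type u) [TopologicalSpace X] (x₀ : X) extends Cov X where
  /-- the basepoint of the total space -/
  base : E
  p_base : p base = x₀

/-- Morphisms of `BCov(X, x₀)`: based morphisms of coverings. -/
@[ext]
structure BCov.Hom {X : Type u} [TopologicalSpace X] {x₀ : X} (A B : BCov X x₀) extends
    Cov.Hom A.toCov B.toCov where
  map_base : map A.base = B.base

instance BCov.category (X : Type u) [TopologicalSpace X] (x₀ : X) :
    Category.{u} (BCov X x₀) where
  Hom A B := BCov.Hom A B
  id A := ⟨⟨ContinuousMap.id A.E, fun _ => rfl⟩, rfl⟩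
  comp s t := ⟨⟨t.map.comp s.map, fun e => (t.comm (s.map e)).trans (s.comm e)⟩,
    (congrArg t.map s.map_base).trans t.map_base⟩

/-- The objects of `BSCov(X, x₀)`: based surjective covering maps. -/
structure BSCov (X : Type u) [TopologicalSpace X] (x₀ : X) extends BCov X x₀ where
  surj : Function.Surjective p

/-- Morphisms of `BSCov(X, x₀)`: based surjective morphisms of coverings. -/
@[ext]
structure BSCov.Hom {X : Type u} [TopologicalSpace X] {x₀ : X} (A B : BSCov X x₀) extends
    toBasedHom : BCov.Hom A.toBCov B.toBCov where
  surj : Function.Surjective map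

instance BSCov.category (X : Type u) [TopologicalSpace X] (x₀ : X) :
    Category.{u} (BSCov X x₀) where
  Hom A B := BSCov.Hom A B
  id A := ⟨⟨⟨ContinuousMap.id A.E, fun _ => rfl⟩, rfl⟩, Function.surjective_id⟩
  comp s t := ⟨⟨⟨t.map.comp s.map, fun e => (t.comm (s.map e)).trans (s.comm e)⟩,
    (congrArg t.map s.map_base).trans t.map_base⟩, t.surj.comp s.surj⟩

/-! ### Pullback -/

section Pullback

variable {X Y : Type u} [TopologicalSpace X] [TopologicalSpace Y]

/-- The projection `f^*(E) = {(x, e) | f x = p e} → X` of the pullback of a covering map `p` is a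
covering map. -/
theorem isCoveringMap_pullback_fst (f : C(X, Y)) {E : Type u} [TopologicalSpace E] {p : E → Y}
    (hp : IsCoveringMap p) :
    IsCoveringMap (fun z : Function.Pullback f p => z.1.1) := by
  intro x
  obtain ⟨hd, U, hxU, hU, hpU, H, hH⟩ := hp (f x)
  have hq : Continuous (fun z : Function.Pullback f p => z.1.1) := by fun_prop
  have key : ∀ (y : U) i, p (H.symm (y, i)).1 = y := fun y i => by
    rw [← hH, H.apply_symm_apply]
  have : IsEvenlyCovered (fun z : Function.Pullback f p => z.1.1) x (p ⁻¹' {f x}) := by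
    refine ⟨hd, f ⁻¹' U, hxU, hU.preimage f.continuous,
      (hU.preimage f.continuous).preimage hq, ?_, ?_⟩
    · exact
      { toFun := fun z => (⟨z.1.1.1, z.2⟩, (H ⟨z.1.1.2, by
          have h1 : f z.1.1.1 ∈ U := z.2
          have h2 := z.1.2
          rw [h2] at h1
          exact h1⟩).2)
        invFun := fun w => ⟨⟨(w.1.1, (H.symm (⟨f w.1.1, w.1.2⟩, w.2)).1),
          (key ⟨f w.1.1, w.1.2⟩ w.2).symm⟩, w.1.2⟩
        left_inv := by
          rintro ⟨⟨⟨a, e⟩, h⟩, ha⟩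
          have h' : f a = p e := h
          have he : e ∈ p ⁻¹' U := by
            have h1 : f a ∈ U := ha
            rwa [h'] at h1
          have h3 : ((⟨f a, ha⟩ : U), (H ⟨e, he⟩).2) = H ⟨e, he⟩ :=
            Prod.ext (Subtype.ext (by rw [hH]; exact h')) rfl
          apply Subtype.ext
          apply Subtype.ext
          apply Prod.ext
          · rfl
          · change (H.symm ((⟨f a, ha⟩ : U), (H ⟨e, he⟩).2)).1 = e
            rw [h3, H.symm_apply_apply]
        right_inv := by
          rintro ⟨⟨a, ha⟩, i⟩
          apply Prod.ext
          · rfl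
          · change (H (H.symm (⟨f a, ha⟩, i))).2 = i
            rw [H.apply_symm_apply]
        continuous_toFun := by fun_prop
        continuous_invFun := by fun_prop }
    · intro z
      rfl
  exact this.to_isEvenlyCovered_preimage

/-- The map `f^*(t) : f^*(E₁) → f^*(E₂)`, `(x, e) ↦ (x, t e)`, of a morphism `t` of coverings. -/
def Cov.Hom.pullbackMap (f : C(X, Y)) {A B : Cov Y} (t : Cov.Hom A B) :
    C(Function.Pullback f A.p, Function.Pullback f B.p) where
  toFun z := ⟨(z.1.1, t.map z.1.2), z.2.trans (t.comm z.1.2).symm⟩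
  continuous_toFun := by fun_prop

theorem Cov.Hom.pullbackMap_surjective (f : C(X, Y)) {A B : Cov Y} (t : Cov.Hom A B)
    (ht : Function.Surjective t.map) : Function.Surjective (t.pullbackMap f) := by
  rintro ⟨⟨x, b⟩, h⟩
  obtain ⟨a, rfl⟩ := ht b
  exact ⟨⟨(x, a), h.trans (t.comm a)⟩, rfl⟩

/-- The pullback of a covering `E → Y` along `f : X → Y`. -/
def Cov.pullbackObj (f : C(X, Y)) (A : Cov Y) : Cov X where
  E := Function.Pullback f A.p
  p := fun z => z.1.1
  isCoveringMap := isCoveringMap_pullback_fst f A.isCoveringMap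

/-- The pullback functor `f^* : Cov(Y) ⥤ Cov(X)`. -/
def Cov.pullback (f : C(X, Y)) : Cov Y ⥤ Cov X where
  obj A := A.pullbackObj f
  map t := ⟨Cov.Hom.pullbackMap f t, fun _ => rfl⟩

/-- The pullback functor `f^* : SCov(Y) ⥤ SCov(X)`. -/
def SCov.pullback (f : C(X, Y)) : SCov Y ⥤ SCov X where
  obj A :=
    { toCov := A.toCov.pullbackObj f
      surj := fun x => (A.surj (f x)).elim fun e he => ⟨⟨(x, e), he.symm⟩, rfl⟩ }
  map t := ⟨⟨Cov.Hom.pullbackMap f t.toHom, fun _ => rfl⟩,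
    Cov.Hom.pullbackMap_surjective f t.toHom t.surj⟩

/-- The pullback of a based covering along a based map `f : (X, x₀) → (Y, y₀)`, based at
`(x₀, e₀)`. -/
def BCov.pullbackObj (f : C(X, Y)) {x₀ : X} {y₀ : Y} (h : f x₀ = y₀) (A : BCov Y y₀) :
    BCov X x₀ where
  toCov := A.toCov.pullbackObj f
  base := ⟨(x₀, A.base), h.trans A.p_base.symm⟩
  p_base := rfl

/-- The pullback functor `f^* : BCov(Y, y₀) ⥤ BCov(X, x₀)` of a based map. -/
def BCov.pullback (f : C(X, Y)) {x₀ : X} {y₀ : Y} (h : f x₀ = y₀) : BCov Y y₀ ⥤ BCov X x₀ where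
  obj A := A.pullbackObj f h
  map t := ⟨⟨Cov.Hom.pullbackMap f t.toHom, fun _ => rfl⟩,
    Subtype.ext (Prod.ext rfl t.map_base)⟩

/-- The pullback functor `f^* : BSCov(Y, y₀) ⥤ BSCov(X, x₀)` of a based map. -/
def BSCov.pullback (f : C(X, Y)) {x₀ : X} {y₀ : Y} (h : f x₀ = y₀) :
    BSCov Y y₀ ⥤ BSCov X x₀ where
  obj A :=
    { toBCov := A.toBCov.pullbackObj f h
      surj := fun x => (A.surj (f x)).elim fun e he => ⟨⟨(x, e), he.symm⟩, rfl⟩ }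
  map t := ⟨⟨⟨Cov.Hom.pullbackMap f t.toBasedHom.toHom, fun _ => rfl⟩,
    Subtype.ext (Prod.ext rfl t.map_base)⟩,
    Cov.Hom.pullbackMap_surjective f t.toBasedHom.toHom t.surj⟩

end Pullback

/-!
For a locally path-connected and semilocally simply-connected space `X`, the monodromy functor
`Cov.monodromy X : Cov X ⥤ (Π₁(X) ⥤ Type u)`, `Π₁` being the fundamental groupoid, is an equivalence.
It is fully faithful because the topology of a covering space is recovered from monodromy along
small paths (`IsCoveringMap.mem_nhds_iff_monodromy`). It is essentially surjective because the
disjoint union of the values of a functor, with the topology defined by the same condition, is a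
covering with the given monodromy (`FundamentalGroupoid.TotalSpace.isCoveringMap_proj`,
`FundamentalGroupoid.TotalSpace.exists_path`). Under these equivalences `f^*` becomes precomposition
with `Φ = Π₁(f)` (`Cov.pullbackMonodromyIso`), and bijectivity of `f` on `π₀` and on all `π₁` says
that `Φ` is an equivalence (`FundamentalGroupoid.isEquivalence_map_iff`).

If `Φ` is an equivalence, then so is precomposition with it, which settles `Cov`. The other three
categories follow, since surjectivity and basepoints can be detected after pulling back: path
lifting moves every fiber to one over the image of `f`.

Conversely, an equivalence in any of the four categories gives faithfulness and fullness of `f^*` on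
surjective endomorphisms fixing a chosen point of each fiber, and essential surjectivity on
surjective coverings. In terms of functors to `Type u`, three test objects then show that `Φ` is an
equivalence: `Hom(x, -) ⊔ {*}` detects faithfulness (`Functor.faithful_of_exists_iso`), the set of
subsets of `Hom(Φ x, -)` with a point added detects fullness
(`Functor.full_of_exists_whiskerLeft_eq`), and a constant functor with an automorphism supported off
the image of `Φ` detects essential surjectivity
(`Functor.exists_hom_of_eq_id_of_whiskerLeft_eq_id`).
-/

/-! ### Precomposition with a functor of groupoids -/

namespace CategoryTheory.Functor

variable {C D : Type u} [Groupoid.{u} C] [Groupoid.{u} D] (Φ : C ⥤ D)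

/-- The functor `c' ↦ Hom(c, c') ⊔ {*}`. -/
def optionHom (c : C) : C ⥤ Type u where
  obj c' := Option (c ⟶ c')
  map g := ↾(Option.map (· ≫ g))
  map_id c' := by
    ext z
    cases z <;> simp
  map_comp g h := by
    ext z
    cases z <;> simp

/-- The functor sending `c'` to the set of subsets of `Hom(c, c')`, with a point `none` added. -/
def optionSetHom (c : C) : C ⥤ Type u where
  obj c' := Option (Set (c ⟶ c'))
  map g := ↾(Option.map (Set.image (· ≫ g)))
  map_id c' := by
    ext z
    cases z <;> simp
  map_comp g h := by
    ext z
    cases z <;> simp [Set.image_image]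

/-- The functor `optionHom x` separates the morphisms out of `x`, so it can be isomorphic to some
`Φ ⋙ G` only if `Φ` does. The added point makes all its values nonempty. -/
theorem faithful_of_exists_iso
    (h : ∀ F : C ⥤ Type u, (∀ c, Nonempty (F.obj c)) → ∃ G : D ⥤ Type u, Nonempty (Φ ⋙ G ≅ F)) :
    Φ.Faithful where
  map_injective {x y} a b hab := by
    obtain ⟨G, ⟨i⟩⟩ := h (optionHom x) (fun _ => ⟨none⟩)
    have key : ∀ g : x ⟶ y, (optionHom x).map g =
        i.inv.app x ≫ G.map (Φ.map g) ≫ i.hom.app y := fun g => by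
      have := i.hom.naturality g
      rw [Functor.comp_map] at this
      rw [this, ← Category.assoc, ← NatTrans.comp_app, i.inv_hom_id, NatTrans.id_app,
        Category.id_comp]
    have h2 : (optionHom x).map a = (optionHom x).map b := by rw [key, key, hab]
    have h3 := types_congr_hom h2 (some (𝟙 x))
    have h4 : (some (𝟙 x ≫ a) : Option (x ⟶ y)) = some (𝟙 x ≫ b) := h3
    simpa using h4

/-- Let `S c` be the set of morphisms `Φ x ⟶ Φ c` in the image of `Φ`. Symmetric difference with `S c`
is an involution of `Φ ⋙ optionSetHom (Φ x)` fixing the added point. If it extends to a natural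
transformation over `D`, then that transformation maps the invariant subset `∅` to an invariant
subset, so `S` is closed under composition with every `δ`; as `𝟙 ∈ S x`, it contains every `δ`. -/
theorem full_of_exists_whiskerLeft_eq
    (h : ∀ (G : D ⥤ Type u) (σ : ∀ d, G.obj d) (τ : Φ ⋙ G ⟶ Φ ⋙ G),
      (∀ c, Function.Surjective (τ.app c)) → (∀ c, τ.app c (σ (Φ.obj c)) = σ (Φ.obj c)) →
      ∃ τ' : G ⟶ G, whiskerLeft Φ τ' = τ) :
    Φ.Full where
  map_surjective {x y} δ := by
    let S : ∀ c : C, Set (Φ.obj x ⟶ Φ.obj c) := fun c => Set.range (Φ.map (X := x) (Y := c))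
    have hS : ∀ {c c' : C} (g : c ⟶ c'), (· ≫ Φ.map g) '' S c = S c' := by
      intro c c' g
      ext w
      constructor
      · rintro ⟨_, ⟨a, rfl⟩, rfl⟩
        exact ⟨a ≫ g, Φ.map_comp a g⟩
      · rintro ⟨a, rfl⟩
        exact ⟨_, ⟨a ≫ Groupoid.inv g, rfl⟩, by simp⟩
    let τ : Φ ⋙ optionSetHom (Φ.obj x) ⟶ Φ ⋙ optionSetHom (Φ.obj x) :=
      { app := fun c => ↾(Option.map (fun T : Set (Φ.obj x ⟶ Φ.obj c) => symmDiff T (S c)))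
        naturality := fun c c' g => by
          ext z
          cases z with
          | none => rfl
          | some T =>
            have hinj : Function.Injective
                (fun w : Φ.obj x ⟶ Φ.obj c => w ≫ Φ.map g) := fun a b hab =>
              (cancel_mono (Φ.map g)).1 hab
            have : symmDiff ((· ≫ Φ.map g) '' T) (S c') = (· ≫ Φ.map g) '' (symmDiff T (S c)) := by
              rw [Set.image_symmDiff hinj, hS]
            exact congrArg some this }
    obtain ⟨τ', hτ'⟩ := h (optionSetHom (Φ.obj x)) (fun _ => none) τ
      (fun c z => by
        cases z with
        | none => exact ⟨none, rfl⟩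
        | some T => exact ⟨some (symmDiff T (S c)),
            congrArg some (symmDiff_symmDiff_cancel_right (S c) T)⟩)
      (fun _ => rfl)
    have happ : ∀ c : C, τ'.app (Φ.obj c) (some ∅) = some (S c) := fun c => by
      have h1 : τ'.app (Φ.obj c) = τ.app c := congr_app hτ' c
      rw [h1]
      exact congrArg some (bot_symmDiff (S c))
    have hn := types_congr_hom (τ'.naturality δ) (some ∅)
    have h2 : τ'.app (Φ.obj y) ((optionSetHom (Φ.obj x)).map δ (some ∅)) =
        (optionSetHom (Φ.obj x)).map δ (τ'.app (Φ.obj x) (some ∅)) := hn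
    have h3 : (optionSetHom (Φ.obj x)).map δ (some ∅) = some ∅ :=
      congrArg some (Set.image_empty _)
    rw [h3, happ, happ] at h2
    have h4 : S y = (· ≫ δ) '' S x := Option.some.inj h2
    have h5 : δ ∈ S y := by
      rw [h4]
      exact ⟨𝟙 _, ⟨𝟙 x, Φ.map_id x⟩, Category.id_comp δ⟩
    exact h5

/-- Negation at the objects that receive no morphism from the image of `Φ` is an automorphism of the
constant functor at `Option Prop`, and it restricts to the identity along `Φ`. -/
theorem exists_hom_of_eq_id_of_whiskerLeft_eq_id
    (h : ∀ (G : D ⥤ Type u) (σ : ∀ d, G.obj d) (τ : G ⟶ G),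
      (∀ d, Function.Surjective (τ.app d)) → (∀ d, τ.app d (σ d) = σ d) →
      whiskerLeft Φ τ = 𝟙 _ → τ = 𝟙 G) (d : D) :
    ∃ c, Nonempty (Φ.obj c ⟶ d) := by
  let P : D → Prop := fun d => ∃ c, Nonempty (Φ.obj c ⟶ d)
  have hP : ∀ {d d' : D} (_ : d ⟶ d'), P d ↔ P d' := fun g =>
    ⟨fun ⟨c, ⟨a⟩⟩ => ⟨c, ⟨a ≫ g⟩⟩, fun ⟨c, ⟨a⟩⟩ => ⟨c, ⟨a ≫ Groupoid.inv g⟩⟩⟩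
  let G : D ⥤ Type u := (Functor.const D).obj (Option (ULift.{u} Prop))
  let τ : G ⟶ G :=
    { app := fun d => ↾(Option.map fun q : ULift.{u} Prop => ⟨q.down ↔ P d⟩)
      naturality := fun d d' g => by
        have : P d = P d' := propext (hP g)
        simp [G, this] }
  have h1 : τ = 𝟙 G := by
    refine h G (fun _ => none) τ (fun d z => ?_) (fun _ => rfl) ?_
    · cases z with
      | none => exact ⟨none, rfl⟩
      | some q =>
        refine ⟨some ⟨q.down ↔ P d⟩, congrArg some (ULift.ext _ _ (propext ?_))⟩
        change ((q.down ↔ P d) ↔ P d) ↔ q.down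
        tauto
    · ext c z
      cases z with
      | none => rfl
      | some q =>
        refine congrArg some (ULift.ext _ _ (propext ?_))
        have : P (Φ.obj c) := ⟨c, ⟨𝟙 _⟩⟩
        change (q.down ↔ P (Φ.obj c)) ↔ q.down
        tauto
  have h2 : τ.app d (some ⟨True⟩) = some ⟨True⟩ := by rw [h1]; rfl
  have h3 : (True ↔ P d) = True := congrArg ULift.down (Option.some.inj h2)
  have h4 : True ↔ P d := by rw [h3]; trivial
  exact h4.1 trivial

end CategoryTheory.Functor

/-! ### Equivalences of fundamental groupoids -/

namespace FundamentalGroupoid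

variable {X Y : Type u} [TopologicalSpace X] [TopologicalSpace Y]

theorem joined_iff_nonempty_hom {x y : X} :
    Joined x y ↔ Nonempty (FundamentalGroupoid.mk x ⟶ FundamentalGroupoid.mk y) :=
  ⟨fun ⟨p⟩ => ⟨fromPath (.mk p)⟩, fun ⟨g⟩ => by
    obtain ⟨p, -⟩ := Path.Homotopic.Quotient.mk_surjective g
    exact ⟨p⟩⟩

theorem isEquivalence_map_iff (f : C(X, Y)) :
    (FundamentalGroupoid.map f).IsEquivalence ↔
      Function.Bijective (pi0Map f) ∧ ∀ x : X, Function.Bijective (FundamentalGroup.map f x) := by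
  constructor
  · intro hE
    refine ⟨⟨?_, ?_⟩, fun x => ⟨?_, ?_⟩⟩
    · rintro ⟨x⟩ ⟨y⟩ hxy
      have h1 : Joined (f x) (f y) := Quotient.exact hxy
      obtain ⟨g⟩ := joined_iff_nonempty_hom.1 h1
      obtain ⟨g', -⟩ := (FundamentalGroupoid.map f).map_surjective (X := ⟨x⟩) (Y := ⟨y⟩)
        (show (FundamentalGroupoid.map f).obj ⟨x⟩ ⟶ (FundamentalGroupoid.map f).obj ⟨y⟩ from g)
      exact Quotient.sound (joined_iff_nonempty_hom.2 ⟨g'⟩)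
    · rintro ⟨y⟩
      let x := (FundamentalGroupoid.map f).objPreimage ⟨y⟩
      have i := (FundamentalGroupoid.map f).objObjPreimageIso ⟨y⟩
      exact ⟨Quotient.mk _ x.as, Quotient.sound (joined_iff_nonempty_hom.2 ⟨i.hom⟩)⟩
    · intro a b hab
      exact (FundamentalGroupoid.map f).map_injective hab
    · intro b
      exact (FundamentalGroupoid.map f).map_surjective b
  · rintro ⟨⟨hinj, hsurj⟩, hπ⟩
    have hfaith : (FundamentalGroupoid.map f).Faithful :=
      { map_injective := fun {x y} a b hab => by
          have h1 : a ≫ Groupoid.inv b = 𝟙 x := by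
            apply (hπ x.as).1
            change (FundamentalGroupoid.map f).map (a ≫ Groupoid.inv b) =
              (FundamentalGroupoid.map f).map (𝟙 x)
            rw [Functor.map_comp, hab, ← Functor.map_comp, Groupoid.comp_inv]
          have h2 := congrArg (· ≫ b) h1
          simpa using h2 }
    have hfull : (FundamentalGroupoid.map f).Full :=
      { map_surjective := fun {x y} δ => by
          have hj : Joined x.as y.as :=
            Quotient.exact (hinj (Quotient.sound (joined_iff_nonempty_hom.2 ⟨δ⟩)))
          obtain ⟨g⟩ := joined_iff_nonempty_hom.1 hj
          obtain ⟨a, ha⟩ := (hπ x.as).2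
            (δ ≫ Groupoid.inv ((FundamentalGroupoid.map f).map (X := x) (Y := y) g))
          have ha' : (FundamentalGroupoid.map f).map (X := x) (Y := x) a =
            δ ≫ Groupoid.inv ((FundamentalGroupoid.map f).map (X := x) (Y := y) g) := ha
          refine ⟨(show x ⟶ x from a) ≫ (show x ⟶ y from g), ?_⟩
          rw [Functor.map_comp, ha', Category.assoc, Groupoid.inv_comp, Category.comp_id] }
    have hess : (FundamentalGroupoid.map f).EssSurj :=
      { mem_essImage := fun y => by
          obtain ⟨⟨x⟩, hx⟩ := hsurj (Quotient.mk _ y.as)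
          obtain ⟨g⟩ := joined_iff_nonempty_hom.1 (Quotient.exact hx : Joined (f x) y.as)
          exact ⟨⟨x⟩, ⟨(Groupoid.isoEquivHom _ _).symm g⟩⟩ }
    exact { }

end FundamentalGroupoid

/-! ### The monodromy functor -/

section LocalMonodromy

variable {E X : Type*} [TopologicalSpace E] [TopologicalSpace X] {p : E → X}

/-- A lift of a path determines the monodromy along it. -/
theorem IsCoveringMap.monodromy_mk_eq (hp : IsCoveringMap p) {x y : X} (γ : Path x y)
    (e : p ⁻¹' {x}) (e' : p ⁻¹' {y}) (Γ : Path e.1 e'.1) (hΓ : ∀ t, p (Γ t) = γ t) :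
    hp.monodromy (.mk γ) e = e' := by
  refine hp.monodromy_eq_of_map_eq (.mk Γ) ?_
  refine congrArg Path.Homotopic.Quotient.mk ?_
  ext t
  exact hΓ t

/-- Over a locally path-connected base, the topology of a covering space is determined by the
monodromy along small paths. -/
theorem IsCoveringMap.mem_nhds_iff_monodromy [LocallyPathConnectedSpace X] (hp : IsCoveringMap p)
    {x : X} {e : E} (hx : p e = x) {W : Set E} :
    W ∈ 𝓝 e ↔ ∃ U ∈ 𝓝 x, ∀ (y : X) (γ : Path x y), Set.range γ ⊆ U →
      (hp.monodromy (.mk γ) ⟨e, hx⟩ : E) ∈ W := by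
  subst hx
  obtain ⟨φ, he, hφ⟩ := hp.isLocalHomeomorph e
  -- paths in the target of a local inverse lift through that inverse
  have key : ∀ (V : Set X), V ⊆ φ.target → ∀ (y : X) (γ : Path (p e) y), Set.range γ ⊆ V →
      (hp.monodromy (.mk γ) ⟨e, rfl⟩ : E) = φ.symm y := by
    intro V hV y γ hγ
    have hmem : ∀ t, γ t ∈ φ.target := fun t => hV (hγ ⟨t, rfl⟩)
    have hy : y ∈ φ.target := by simpa using hmem 1
    have hpφ : ∀ z ∈ φ.target, p (φ.symm z) = z := fun z hz => by
      rw [hφ]; exact φ.right_inv hz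
    let Γ : Path e (φ.symm y) :=
      { toFun := fun t => φ.symm (γ t)
        continuous_toFun := φ.continuousOn_symm.comp_continuous γ.continuous hmem
        source' := by
          rw [γ.source, hφ]; exact φ.left_inv he
        target' := by rw [γ.target] }
    exact congrArg Subtype.val
      (hp.monodromy_mk_eq γ ⟨e, rfl⟩ ⟨φ.symm y, hpφ y hy⟩ Γ fun t => hpφ _ (hmem t))
  have hpe : p e ∈ φ.target := by
    rw [hφ]; exact φ.map_source he
  have hsymm : φ.symm (p e) = e := by
    rw [hφ]; exact φ.left_inv he
  constructor
  · intro hW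
    refine ⟨φ.target ∩ φ.symm ⁻¹' W, ?_, fun y γ hγ => ?_⟩
    · refine Filter.inter_mem (φ.open_target.mem_nhds hpe) ?_
      refine (φ.continuousAt_symm hpe).preimage_mem_nhds ?_
      rwa [hsymm]
    · rw [key _ Set.inter_subset_left y γ hγ]
      have : y ∈ φ.target ∩ φ.symm ⁻¹' W := hγ ⟨1, γ.target⟩
      exact this.2
  · rintro ⟨U, hU, h⟩
    obtain ⟨V, ⟨hV, hVc⟩, hVU⟩ := (path_connected_basis (p e)).mem_iff.1
      (Filter.inter_mem hU (φ.open_target.mem_nhds hpe))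
    have h1 : φ.source ∩ p ⁻¹' V ∈ 𝓝 e :=
      Filter.inter_mem (φ.open_source.mem_nhds he) (hp.continuous.continuousAt.preimage_mem_nhds hV)
    refine Filter.mem_of_superset h1 ?_
    rintro e' ⟨he's, he'V⟩
    obtain ⟨γ, hγ⟩ := hVc.joinedIn (p e) (mem_of_mem_nhds hV) (p e') he'V
    have hr : Set.range γ ⊆ V := by
      rintro _ ⟨t, rfl⟩; exact hγ t
    have h2 := h (p e') γ (hr.trans (hVU.trans Set.inter_subset_left))
    rw [key V (hVU.trans Set.inter_subset_right) _ γ hr] at h2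
    have h3 : φ.symm (p e') = e' := by
      rw [hφ]; exact φ.left_inv he's
    rwa [h3] at h2

end LocalMonodromy

namespace Cov

variable {X Y : Type u} [TopologicalSpace X] [TopologicalSpace Y]

variable (X) in
/-- The functor sending a covering to the action of the fundamental groupoid on its fibers. -/
noncomputable def monodromy : Cov X ⥤ (FundamentalGroupoid X ⥤ Type u) where
  obj A := A.isCoveringMap.monodromyFunctor
  map {A B} t :=
    { app := fun x => ↾fun e : A.p ⁻¹' {x.as} =>
        (⟨t.map e.1, (t.comm e.1).trans e.2⟩ : B.p ⁻¹' {x.as})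
      naturality := fun x y g => by
        ext e
        obtain ⟨γ, rfl⟩ := Path.Homotopic.Quotient.mk_surjective g
        have h0 : γ 0 = A.p e.1 := γ.source.trans e.2.symm
        let Γ : Path e.1 (A.isCoveringMap.liftPath γ e.1 h0 1) :=
          ⟨A.isCoveringMap.liftPath γ e.1 h0, A.isCoveringMap.liftPath_zero _ _ _, rfl⟩
        refine (B.isCoveringMap.monodromy_mk_eq γ
          ⟨t.map e.1, (t.comm e.1).trans e.2⟩ ⟨t.map (A.isCoveringMap.monodromy (.mk γ) e).1,
            (t.comm _).trans (A.isCoveringMap.monodromy (.mk γ) e).2⟩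
          (Γ.map t.map.continuous) fun s => ?_).symm
        exact (t.comm _).trans (congrFun (A.isCoveringMap.liftPath_lifts γ e.1 h0) s) }
  map_id _ := rfl
  map_comp _ _ := rfl

instance : (monodromy X).Faithful where
  map_injective {A B} s t h := by
    refine Cov.Hom.ext (ContinuousMap.ext fun e => ?_)
    exact congrArg Subtype.val (types_congr_hom (congr_app h ⟨A.p e⟩) ⟨e, rfl⟩)

instance [LocallyPathConnectedSpace X] : (monodromy X).Full where
  map_surjective {A B} τ := by
    let n (x : X) (e : A.p ⁻¹' {x}) : B.p ⁻¹' {x} := TypeCat.Hom.hom (τ.app ⟨x⟩) e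
    let m : A.E → B.E := fun e => (n (A.p e) ⟨e, rfl⟩).1
    have hm : ∀ (x : X) (e : A.p ⁻¹' {x}), (n x e).1 = m e.1 := by
      rintro x ⟨e, rfl⟩; rfl
    have hp : ∀ e, B.p (m e) = A.p e := fun e => (n (A.p e) ⟨e, rfl⟩).2
    have hmon : ∀ (x y : X) (γ : Path x y) (e : A.p ⁻¹' {x}),
        n y (A.isCoveringMap.monodromy (.mk γ) e) =
          B.isCoveringMap.monodromy (.mk γ) (n x e) := fun x y γ e =>
      types_congr_hom (τ.naturality (FundamentalGroupoid.fromPath (.mk γ))) e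
    have hc : Continuous m := by
      refine continuous_iff_continuousAt.2 fun e W hW => ?_
      obtain ⟨U, hU, h⟩ := (B.isCoveringMap.mem_nhds_iff_monodromy (hp e)).1 hW
      refine (A.isCoveringMap.mem_nhds_iff_monodromy rfl).2 ⟨U, hU, fun y γ hγ => ?_⟩
      change m _ ∈ W
      rw [← hm, hmon]
      exact h y γ hγ
    refine ⟨⟨⟨m, hc⟩, hp⟩, ?_⟩
    ext x e
    exact Subtype.ext (hm x.as e).symm

/-- The monodromy action on a pulled back covering is the action on the original covering,
restricted along the map of fundamental groupoids. -/
noncomputable def pullbackMonodromyIso (f : C(X, Y)) :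
    Cov.pullback f ⋙ monodromy X ≅
      monodromy Y ⋙ (Functor.whiskeringLeft _ _ (Type u)).obj (FundamentalGroupoid.map f) :=
  NatIso.ofComponents (fun A => NatIso.ofComponents (fun x => Equiv.toIso
    { toFun := fun z : (fun z : Function.Pullback f A.p => z.1.1) ⁻¹' {x.as} =>
        (⟨z.1.1.2, z.1.2.symm.trans (congrArg f z.2)⟩ : A.p ⁻¹' {f x.as})
      invFun := fun e : A.p ⁻¹' {f x.as} =>
        (⟨⟨(x.as, e.1), e.2.symm⟩, rfl⟩ :
          (fun z : Function.Pullback f A.p => z.1.1) ⁻¹' {x.as})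
      left_inv := fun z => Subtype.ext (Subtype.ext (Prod.ext z.2.symm rfl))
      right_inv := fun _ => rfl })
    (fun {x y} g => by
      ext z
      obtain ⟨γ, rfl⟩ := Path.Homotopic.Quotient.mk_surjective g
      let C := A.pullbackObj f
      let z' : C.p ⁻¹' {x.as} := z
      let q : C(C.E, A.E) :=
        ⟨fun z : Function.Pullback f A.p => z.1.2, continuous_snd.comp continuous_subtype_val⟩
      have hq : ∀ v : C.E, A.p (q v) = f (C.p v) := fun v => v.2.symm
      have h0 : γ 0 = C.p z'.1 := γ.source.trans z'.2.symm
      let w := C.isCoveringMap.monodromy (.mk γ) z'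
      let Γ : Path z'.1 w.1 :=
        ⟨C.isCoveringMap.liftPath γ z'.1 h0, C.isCoveringMap.liftPath_zero _ _ _, rfl⟩
      have hΓ : ∀ s, C.p (Γ s) = γ s := fun s =>
        congrFun (C.isCoveringMap.liftPath_lifts γ z'.1 h0) s
      exact (A.isCoveringMap.monodromy_mk_eq (γ.map f.continuous)
        ⟨q z'.1, (hq _).trans (congrArg f z'.2)⟩ ⟨q w.1, (hq _).trans (congrArg f w.2)⟩
        (Γ.map q.continuous) fun s => (hq _).trans (congrArg f (hΓ s))).symm))
    (fun t => rfl)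

end Cov

/-! ### The covering with given monodromy -/

namespace SemilocallySimplyConnected

variable {X : Type u} [TopologicalSpace X]

/-- The path component of `x` in the neighborhood given by semilocal simple connectedness has the
property for all pairs of its points, not only for loops at `x`: prefix a path from `x`. -/
theorem exists_isPathConnected [LocallyPathConnectedSpace X] (h : SemilocallySimplyConnected X)
    (x : X) : ∃ U : Set X, IsOpen U ∧ x ∈ U ∧ IsPathConnected U ∧
      ∀ (a b : X) (γ γ' : Path a b), Set.range γ ⊆ U → Set.range γ' ⊆ U → γ.Homotopic γ' := by
  obtain ⟨V, hV, hx, hπ⟩ := h x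
  have hloop : ∀ γ : Path x x, Set.range γ ⊆ V → γ.Homotopic (Path.refl x) := by
    intro γ hγ
    let γ' : Path (⟨x, hx⟩ : V) ⟨x, hx⟩ :=
      { toFun := fun t => ⟨γ t, hγ ⟨t, rfl⟩⟩
        continuous_toFun := by fun_prop
        source' := Subtype.ext γ.source
        target' := Subtype.ext γ.target }
    exact Path.Homotopic.Quotient.exact (hπ (FundamentalGroup.fromPath (.mk γ')))
  refine ⟨pathComponentIn V x, hV.pathComponentIn x, mem_pathComponentIn_self hx,
    isPathConnected_pathComponentIn hx, fun a b γ γ' hγ hγ' => ?_⟩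
  have ha : a ∈ pathComponentIn V x := hγ ⟨0, γ.source⟩
  obtain ⟨δ, hδ⟩ := ha
  have hδ' : Set.range δ ⊆ V := by rintro _ ⟨t, rfl⟩; exact hδ t
  have h1 := hloop ((δ.trans γ).trans (δ.trans γ').symm) (by
    have hVV : pathComponentIn V x ⊆ V := pathComponentIn_subset
    rw [Path.trans_range, Path.symm_range, Path.trans_range, Path.trans_range]
    exact Set.union_subset (Set.union_subset hδ' (hγ.trans hVV))
      (Set.union_subset hδ' (hγ'.trans hVV)))
  have h2 : FundamentalGroupoid.fromPath (.mk δ) ≫ FundamentalGroupoid.fromPath (.mk γ) =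
      FundamentalGroupoid.fromPath (.mk δ) ≫ FundamentalGroupoid.fromPath (.mk γ') := by
    rw [← cancel_mono (Groupoid.inv (FundamentalGroupoid.fromPath (.mk δ) ≫
      FundamentalGroupoid.fromPath (.mk γ'))), Groupoid.comp_inv]
    exact Path.Homotopic.Quotient.eq.2 h1
  exact Path.Homotopic.Quotient.exact ((cancel_epi _).1 h2)

end SemilocallySimplyConnected

namespace FundamentalGroupoid

variable {X : Type u} [TopologicalSpace X]

section transport

variable (F : FundamentalGroupoid X ⥤ Type u)

/-- The map between values of `F` given by a path. -/
def transport {x y : X} (γ : Path x y) (a : F.obj ⟨x⟩) : F.obj ⟨y⟩ :=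
  F.map (fromPath (.mk γ)) a

variable {F}

@[simp]
theorem transport_refl {x : X} (a : F.obj ⟨x⟩) : transport F (Path.refl x) a = a :=
  types_congr_hom (F.map_id ⟨x⟩) a

theorem transport_trans {x y z : X} (γ : Path x y) (γ' : Path y z) (a : F.obj ⟨x⟩) :
    transport F (γ.trans γ') a = transport F γ' (transport F γ a) :=
  types_congr_hom (F.map_comp (fromPath (.mk γ)) (fromPath (.mk γ'))) a

theorem transport_congr {x y : X} {γ γ' : Path x y} (h : γ.Homotopic γ') (a : F.obj ⟨x⟩) :
    transport F γ a = transport F γ' a := by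
  rw [transport, Path.Homotopic.Quotient.eq.2 h, transport]

theorem transport_symm_transport {x y : X} (γ : Path x y) (a : F.obj ⟨x⟩) :
    transport F γ.symm (transport F γ a) = a := by
  rw [← transport_trans, transport_congr (Path.Homotopic.trans_symm γ), transport_refl]

theorem transport_transport_symm {x y : X} (γ : Path x y) (a : F.obj ⟨y⟩) :
    transport F γ (transport F γ.symm a) = a := by
  rw [← transport_trans, transport_congr (Path.Homotopic.symm_trans γ), transport_refl]

end transport

/-- The disjoint union of the values of a functor on the fundamental groupoid of `X`: the total
space of the covering with this monodromy. -/
structure TotalSpace (F : FundamentalGroupoid X ⥤ Type u) : Type u where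
  /-- the point of the base -/
  fst : X
  /-- the point of the fiber -/
  snd : F.obj ⟨fst⟩

namespace TotalSpace

variable {F : FundamentalGroupoid X ⥤ Type u}

/-- A set is open if it contains, with each point, everything reached from it by transport along
sufficiently small paths. -/
instance : TopologicalSpace (TotalSpace F) where
  IsOpen W := ∀ z ∈ W, ∃ U ∈ 𝓝 z.1, ∀ (y : X) (γ : Path z.1 y), Set.range γ ⊆ U →
    (⟨y, transport F γ z.2⟩ : TotalSpace F) ∈ W
  isOpen_univ _ _ := ⟨Set.univ, Filter.univ_mem, fun _ _ _ => trivial⟩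
  isOpen_inter W W' h h' z hz := by
    obtain ⟨U, hU, hUW⟩ := h z hz.1
    obtain ⟨U', hU', hUW'⟩ := h' z hz.2
    exact ⟨U ∩ U', Filter.inter_mem hU hU', fun y γ hγ =>
      ⟨hUW y γ (hγ.trans Set.inter_subset_left), hUW' y γ (hγ.trans Set.inter_subset_right)⟩⟩
  isOpen_sUnion S h z hz := by
    obtain ⟨W, hW, hzW⟩ := hz
    obtain ⟨U, hU, hUW⟩ := h W hW z hzW
    exact ⟨U, hU, fun y γ hγ => ⟨W, hW, hUW y γ hγ⟩⟩

theorem isOpen_iff {W : Set (TotalSpace F)} :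
    IsOpen W ↔ ∀ z ∈ W, ∃ U ∈ 𝓝 z.1, ∀ (y : X) (γ : Path z.1 y), Set.range γ ⊆ U →
      (⟨y, transport F γ z.2⟩ : TotalSpace F) ∈ W := Iff.rfl

variable (F) in
/-- The projection to the base. -/
def proj (z : TotalSpace F) : X := z.1

theorem continuous_proj : Continuous (proj F) := by
  refine continuous_def.2 fun V hV => isOpen_iff.2 fun z hz => ⟨V, hV.mem_nhds hz, ?_⟩
  exact fun y γ hγ => hγ ⟨1, γ.target⟩

theorem isCoveringMap_proj [LocallyPathConnectedSpace X] (hX : SemilocallySimplyConnected X) :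
    IsCoveringMap (proj F) := by
  intro x
  obtain ⟨U, hU, hxU, hUc, hπ⟩ := hX.exists_isPathConnected x
  have hpath : ∀ y : U, ∃ γ : Path x y.1, Set.range γ ⊆ U := fun y => by
    obtain ⟨γ, hγ⟩ := hUc.joinedIn x hxU y.1 y.2
    exact ⟨γ, by rintro _ ⟨t, rfl⟩; exact hγ t⟩
  choose g hg using hpath
  have hgsymm : ∀ y, Set.range (g y).symm ⊆ U := fun y => by
    rw [Path.symm_range]; exact hg y
  -- transport from `x` within `U` does not depend on the path
  have hgtrans : ∀ (y z : U) (γ : Path y.1 z.1), Set.range γ ⊆ U → ∀ a : F.obj ⟨x⟩,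
      transport F γ (transport F (g y) a) = transport F (g z) a := fun y z γ hγ a => by
    rw [← transport_trans]
    refine transport_congr (hπ _ _ _ _ ?_ (hg z)) a
    rw [Path.trans_range]
    exact Set.union_subset (hg y) hγ
  let _ : TopologicalSpace (F.obj ⟨x⟩) := ⊥
  have : DiscreteTopology (F.obj ⟨x⟩) := ⟨rfl⟩
  let H : proj F ⁻¹' U ≃ U × F.obj ⟨x⟩ :=
    { toFun := fun z => (⟨z.1.1, z.2⟩, transport F (g ⟨z.1.1, z.2⟩).symm z.1.2)
      invFun := fun w => ⟨⟨w.1.1, transport F (g w.1) w.2⟩, w.1.2⟩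
      left_inv := fun ⟨⟨y, a⟩, hy⟩ =>
        Subtype.ext (congrArg (TotalSpace.mk y) (transport_transport_symm _ _))
      right_inv := fun ⟨y, a⟩ => Prod.ext rfl (transport_symm_transport _ _) }
  have hH : Continuous H := by
    refine Continuous.prodMk ?_ ?_
    · exact (continuous_proj.comp continuous_subtype_val).subtype_mk _
    · refine continuous_discrete_rng.2 fun a => ?_
      refine isOpen_induced_iff.2 ⟨{z | ∃ h : z.1 ∈ U, transport F (g ⟨z.1, h⟩).symm z.2 = a}, ?_, ?_⟩
      · refine isOpen_iff.2 ?_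
        rintro ⟨y, b⟩ ⟨hy, rfl⟩
        refine ⟨U, hU.mem_nhds hy, fun z γ hγ => ?_⟩
        have hz : z ∈ U := hγ ⟨1, γ.target⟩
        refine ⟨hz, ?_⟩
        have h1 := hgtrans ⟨y, hy⟩ ⟨z, hz⟩ γ hγ (transport F (g ⟨y, hy⟩).symm b)
        rw [transport_transport_symm] at h1
        change transport F (g ⟨z, hz⟩).symm (transport F γ b) = _
        rw [h1, transport_symm_transport]
      · ext z
        exact ⟨fun ⟨_, h⟩ => h, fun h => ⟨z.2, h⟩⟩
  have hHsymm : Continuous H.symm := by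
    refine Continuous.subtype_mk ?_ _
    refine continuous_def.2 fun W hW => isOpen_iff_mem_nhds.2 ?_
    rintro ⟨y, a⟩ hya
    obtain ⟨V, hV, hVW⟩ := isOpen_iff.1 hW _ hya
    obtain ⟨N, ⟨hN, hNc⟩, hNV⟩ := (path_connected_basis y.1).mem_iff.1
      (Filter.inter_mem hV (hU.mem_nhds y.2))
    have h1 : (Subtype.val ⁻¹' N : Set U) ×ˢ {a} ∈ 𝓝 (y, a) :=
      prod_mem_nhds (continuous_subtype_val.continuousAt.preimage_mem_nhds hN)
        (by simp)
    refine Filter.mem_of_superset h1 ?_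
    rintro ⟨z, b⟩ ⟨hz, rfl⟩
    obtain ⟨γ, hγ⟩ := hNc.joinedIn y.1 (mem_of_mem_nhds hN) z.1 hz
    have hr : Set.range γ ⊆ N := by rintro _ ⟨t, rfl⟩; exact hγ t
    have h2 := hVW z.1 γ (hr.trans (hNV.trans Set.inter_subset_left))
    have h3 := hgtrans y z γ (hr.trans (hNV.trans Set.inter_subset_right)) b
    change (⟨z.1, transport F (g z) b⟩ : TotalSpace F) ∈ W
    rw [← h3]
    exact h2
  exact IsEvenlyCovered.to_isEvenlyCovered_preimage (I := F.obj ⟨x⟩)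
    ⟨inferInstance, U, hxU, hU, hU.preimage continuous_proj,
      { toEquiv := H, continuous_toFun := hH, continuous_invFun := hHsymm }, fun _ => rfl⟩

/-- Transport along the initial segments of a path is a path in the total space. -/
theorem exists_path {x y : X} (γ : Path x y) (a : F.obj ⟨x⟩) :
    ∃ Γ : Path (X := TotalSpace F) ⟨x, a⟩ ⟨y, transport F γ a⟩, ∀ t, proj F (Γ t) = γ t := by
  obtain ⟨γ, rfl, rfl⟩ := γ
  let γ' : Path (γ 0) (γ 1) := ⟨γ, rfl, rfl⟩
  let c : unitInterval → TotalSpace F := fun t => ⟨γ t, transport F (γ'.subpath 0 t) a⟩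
  refine ⟨{ toFun := c, continuous_toFun := ?_, source' := ?_, target' := ?_ }, fun t => rfl⟩
  · refine continuous_def.2 fun W hW => isOpen_iff_mem_nhds.2 fun t₀ ht₀ => ?_
    obtain ⟨U, hU, hUW⟩ := isOpen_iff.1 hW _ ht₀
    have h1 : ∀ᶠ t in 𝓝 t₀, Set.uIcc t₀ t ⊆ γ ⁻¹' U :=
      Filter.tendsto_smallSets_iff.1
        (Filter.Tendsto.uIcc tendsto_const_nhds Filter.tendsto_id) _
        (γ.continuous.continuousAt.preimage_mem_nhds hU)
    filter_upwards [h1] with t ht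
    have h2 := hUW (γ t) (γ'.subpath t₀ t) (by
      rw [Path.range_subpath]
      exact Set.image_subset_iff.2 ht)
    rw [← transport_trans, transport_congr ⟨Path.Homotopy.subpathTransSubpath γ' 0 t₀ t⟩] at h2
    exact h2
  · change (⟨γ 0, transport F (γ'.subpath 0 0) a⟩ : TotalSpace F) = _
    rw [Path.subpath_self]
    exact congrArg (TotalSpace.mk (γ 0)) (transport_refl a)
  · change (⟨γ 1, transport F (γ'.subpath 0 1) a⟩ : TotalSpace F) = _
    rw [Path.subpath_zero_one]
    rfl

end TotalSpace

end FundamentalGroupoid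

namespace Cov

variable {X : Type u} [TopologicalSpace X]

open FundamentalGroupoid

/-- The covering with prescribed monodromy. -/
def ofFunctor [LocallyPathConnectedSpace X] (hX : SemilocallySimplyConnected X)
    (F : FundamentalGroupoid X ⥤ Type u) : Cov X where
  E := TotalSpace F
  p := TotalSpace.proj F
  isCoveringMap := TotalSpace.isCoveringMap_proj hX

theorem monodromy_essSurj [LocallyPathConnectedSpace X] (hX : SemilocallySimplyConnected X) :
    (monodromy X).EssSurj where
  mem_essImage F := by
    let i (x : FundamentalGroupoid X) (a : F.obj x) : TotalSpace.proj F ⁻¹' {x.as} :=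
      ⟨⟨x.as, a⟩, rfl⟩
    have hi : ∀ x, Function.Bijective (i x) := fun x => by
      refine ⟨fun a b h => 
      eq_of_heq (TotalSpace.mk.inj (congrArg Subtype.val h)).2, ?_⟩
      rintro ⟨⟨y, a⟩, h⟩
      have h' : y = x.as := h
      subst h'
      exact ⟨a, rfl⟩
    let ε (x : FundamentalGroupoid X) := Equiv.ofBijective (i x) (hi x)
    refine ⟨ofFunctor hX F, ⟨(NatIso.ofComponents (fun x => (ε x).toIso) fun {x y} g => ?_).symm⟩⟩
    ext a
    obtain ⟨γ, rfl⟩ := Path.Homotopic.Quotient.mk_surjective g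
    obtain ⟨Γ, hΓ⟩ := TotalSpace.exists_path γ a
    exact ((ofFunctor hX F).isCoveringMap.monodromy_mk_eq γ (ε x a) (ε y (transport F γ a)) Γ
      hΓ).symm

theorem monodromy_isEquivalence [LocallyPathConnectedSpace X]
    (hX : SemilocallySimplyConnected X) : (monodromy X).IsEquivalence :=
  have := monodromy_essSurj hX
  { }

end Cov

/-! ### Pullback of coverings and the fundamental groupoid -/

namespace Cov

variable {X Y : Type u} [TopologicalSpace X] [TopologicalSpace Y]

theorem surjective_map_iff {A B : Cov X} (t : A ⟶ B) :
    Function.Surjective t.map ↔ ∀ x, Function.Surjective (((monodromy X).map t).app x) := by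
  constructor
  · rintro h x ⟨b, hb⟩
    obtain ⟨a, rfl⟩ := h b
    exact ⟨⟨a, (t.comm a).symm.trans hb⟩, rfl⟩
  · intro h b
    obtain ⟨a, ha⟩ := h ⟨B.p b⟩ ⟨b, rfl⟩
    exact ⟨a.1, congrArg Subtype.val ha⟩

theorem surjective_iso_hom_map {A B : Cov X} (i : A ≅ B) : Function.Surjective i.hom.map := fun b =>
  ⟨i.inv.map b, DFunLike.congr_fun (congrArg Cov.Hom.map i.inv_hom_id) b⟩

theorem isEquivalence_pullback [LocallyPathConnectedSpace X] [LocallyPathConnectedSpace Y]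
    (hX : SemilocallySimplyConnected X) (hY : SemilocallySimplyConnected Y) (f : C(X, Y))
    (hf : (FundamentalGroupoid.map f).IsEquivalence) : (Cov.pullback f).IsEquivalence := by
  have := monodromy_isEquivalence hX
  have := monodromy_isEquivalence hY
  have : (Cov.pullback f ⋙ monodromy X).IsEquivalence :=
    Functor.isEquivalence_of_iso (pullbackMonodromyIso f).symm
  exact Functor.isEquivalence_of_comp_right (Cov.pullback f) (monodromy X)

/-- The hypotheses are the part of the equivalence property of `f^*` that the four categories of
coverings have in common: faithfulness and fullness on surjective endomorphisms that fix a chosen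
point `σ y` over every `y`, and essential surjectivity on surjective coverings. Choosing `σ y₀` as
basepoint makes such endomorphisms morphisms of all four categories. -/
theorem isEquivalence_fundamentalGroupoid_map
    [LocallyPathConnectedSpace X] [LocallyPathConnectedSpace Y]
    (hX : SemilocallySimplyConnected X) (hY : SemilocallySimplyConnected Y) (f : C(X, Y))
    (faithful : ∀ (A : Cov Y) (σ : Y → A.E), (∀ y, A.p (σ y) = y) → ∀ t : A ⟶ A,
      Function.Surjective t.map → (∀ y, t.map (σ y) = σ y) →
      (Cov.pullback f).map t = 𝟙 _ → t = 𝟙 A)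
    (full : ∀ (A : Cov Y) (σ : Y → A.E) (hσ : ∀ y, A.p (σ y) = y)
      (s : A.pullbackObj f ⟶ A.pullbackObj f), Function.Surjective s.map →
      (∀ x, s.map ⟨(x, σ (f x)), (hσ (f x)).symm⟩ = ⟨(x, σ (f x)), (hσ (f x)).symm⟩) →
      ∃ t : A ⟶ A, (Cov.pullback f).map t = s)
    (essSurj : ∀ C : Cov X, Function.Surjective C.p →
      ∃ A : Cov Y, Nonempty ((Cov.pullback f).obj A ≅ C)) :
    (FundamentalGroupoid.map f).IsEquivalence := by
  have := monodromy_isEquivalence hX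
  have := monodromy_isEquivalence hY
  let Φ := FundamentalGroupoid.map f
  let K := pullbackMonodromyIso f
  have h1 : Φ.Faithful := Φ.faithful_of_exists_iso fun F hF => by
    let i := (monodromy X).objObjPreimageIso F
    obtain ⟨A, ⟨e⟩⟩ := essSurj ((monodromy X).objPreimage F) fun x => by
      obtain ⟨a⟩ := hF ⟨x⟩
      let c := TypeCat.Hom.hom (i.inv.app ⟨x⟩) a
      exact ⟨c.1, c.2⟩
    exact ⟨(monodromy Y).obj A, ⟨(K.app A).symm ≪≫ (monodromy X).mapIso e ≪≫ i⟩⟩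
  have h2 : Φ.Full := Φ.full_of_exists_whiskerLeft_eq fun G σ τ hτ hτσ => by
    let A := (monodromy Y).objPreimage G
    let i : (monodromy Y).obj A ≅ G := (monodromy Y).objObjPreimageIso G
    let κ : (monodromy X).obj (A.pullbackObj f) ≅ Φ ⋙ (monodromy Y).obj A := K.app A
    let α : (monodromy X).obj (A.pullbackObj f) ≅ Φ ⋙ G := κ ≪≫ Functor.isoWhiskerLeft Φ i
    let s : A.pullbackObj f ⟶ A.pullbackObj f := (monodromy X).preimage (α.hom ≫ τ ≫ α.inv)
    have hs : (monodromy X).map s = α.hom ≫ τ ≫ α.inv := (monodromy X).map_preimage _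
    let σ' (y : Y) : A.p ⁻¹' {y} := TypeCat.Hom.hom (i.inv.app ⟨y⟩) (σ ⟨y⟩)
    obtain ⟨t, ht⟩ := full A (fun y => (σ' y).1) (fun y => (σ' y).2) s
      ((surjective_map_iff s).2 fun x => by
        rw [hs]
        have hα : Function.Surjective (α.hom.app x) :=
          ((isIso_iff_bijective (α.hom.app x)).1 inferInstance).2
        have hα' : Function.Surjective (α.inv.app x) :=
          ((isIso_iff_bijective (α.inv.app x)).1 inferInstance).2
        exact hα'.comp ((hτ x).comp hα))
      (fun x => by
        let z : (A.pullbackObj f).p ⁻¹' {x} := ⟨⟨(x, (σ' (f x)).1), (σ' (f x)).2.symm⟩, rfl⟩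
        have hz : α.hom.app ⟨x⟩ z = σ ⟨f x⟩ :=
          types_congr_hom (congr_app i.inv_hom_id ⟨f x⟩) (σ ⟨f x⟩)
        have hz' : α.inv.app ⟨x⟩ (σ ⟨f x⟩) = z := by
          rw [← hz]
          exact types_congr_hom (congr_app α.hom_inv_id ⟨x⟩) z
        have h3 : ((monodromy X).map s).app ⟨x⟩ z = z := by
          rw [hs]
          change α.inv.app ⟨x⟩ (τ.app ⟨x⟩ (α.hom.app ⟨x⟩ z)) = z
          rw [hz]
          exact (congrArg (α.inv.app ⟨x⟩) (hτσ ⟨x⟩)).trans hz'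
        exact congrArg Subtype.val h3)
    refine ⟨i.inv ≫ (monodromy Y).map t ≫ i.hom, ?_⟩
    have hK : (monodromy X).map s ≫ κ.hom =
        κ.hom ≫ Functor.whiskerLeft Φ ((monodromy Y).map t) := by
      rw [← ht]
      exact K.hom.naturality t
    have hα : α.hom = κ.hom ≫ Functor.whiskerLeft Φ i.hom := rfl
    have h3 : α.hom ≫ Functor.whiskerLeft Φ (i.inv ≫ (monodromy Y).map t ≫ i.hom) =
        α.hom ≫ τ := by
      rw [hα, Category.assoc, ← Functor.whiskerLeft_comp, i.hom_inv_id_assoc,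
        Functor.whiskerLeft_comp, ← Category.assoc, ← hK, Category.assoc, ← hα, hs,
        Category.assoc, Category.assoc, α.inv_hom_id, Category.comp_id]
    exact (cancel_epi α.hom).1 h3
  have h3 : Φ.EssSurj :=
    { mem_essImage := fun y => by
        obtain ⟨x, ⟨g⟩⟩ := Φ.exists_hom_of_eq_id_of_whiskerLeft_eq_id
          (fun G σ τ hτ hτσ hτf => by
            let A := (monodromy Y).objPreimage G
            let i : (monodromy Y).obj A ≅ G := (monodromy Y).objObjPreimageIso G
            let t : A ⟶ A := (monodromy Y).preimage (i.hom ≫ τ ≫ i.inv)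
            have ht : (monodromy Y).map t = i.hom ≫ τ ≫ i.inv := (monodromy Y).map_preimage _
            let σ' (y : Y) : A.p ⁻¹' {y} := TypeCat.Hom.hom (i.inv.app ⟨y⟩) (σ ⟨y⟩)
            have h4 : t = 𝟙 A := by
              refine faithful A (fun y => (σ' y).1) (fun y => (σ' y).2) t
                ((surjective_map_iff t).2 fun y => ?_) (fun y => ?_) ?_
              · rw [ht]
                have hi : Function.Surjective (i.hom.app y) :=
                  ((isIso_iff_bijective (i.hom.app y)).1 inferInstance).2
                have hi' : Function.Surjective (i.inv.app y) :=
                  ((isIso_iff_bijective (i.inv.app y)).1 inferInstance).2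
                exact hi'.comp ((hτ y).comp hi)
              · have h5 : ((monodromy Y).map t).app ⟨y⟩ (σ' y) = σ' y := by
                  rw [ht]
                  change i.inv.app ⟨y⟩ (τ.app ⟨y⟩ (i.hom.app ⟨y⟩ (i.inv.app ⟨y⟩ (σ ⟨y⟩)))) = _
                  have h6 : i.hom.app ⟨y⟩ (i.inv.app ⟨y⟩ (σ ⟨y⟩)) = σ ⟨y⟩ :=
                    types_congr_hom (congr_app i.inv_hom_id ⟨y⟩) (σ ⟨y⟩)
                  rw [h6, hτσ]
                exact congrArg Subtype.val h5
              · apply (monodromy X).map_injective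
                rw [← cancel_mono (K.hom.app A)]
                refine (K.hom.naturality t).trans ?_
                have h5 : Functor.whiskerLeft Φ ((monodromy Y).map t) = 𝟙 _ := by
                  rw [ht, Functor.whiskerLeft_comp, Functor.whiskerLeft_comp, hτf,
                    Category.id_comp, ← Functor.whiskerLeft_comp, i.hom_inv_id]
                  rfl
                change K.hom.app A ≫ Functor.whiskerLeft Φ ((monodromy Y).map t) = _
                rw [h5]
                rfl
            rw [h4, (monodromy Y).map_id A] at ht
            have h5 : i.hom ≫ τ ≫ i.inv = i.hom ≫ 𝟙 G ≫ i.inv := by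
              rw [← ht]; simp
            exact (cancel_mono i.inv).1 ((cancel_epi i.hom).1 h5)) y
        exact ⟨x, ⟨(Groupoid.isoEquivHom _ _).symm g⟩⟩ }
  exact { }

/-- Lifting paths that start in the image of `f` reduces surjectivity over any point to surjectivity
over the image. -/
theorem surjective_map_of_pullback {f : C(X, Y)} (hf : Function.Surjective (pi0Map f)) {A B : Cov Y}
    (t : A ⟶ B) (ht : Function.Surjective ((Cov.pullback f).map t).map) :
    Function.Surjective t.map := by
  intro b
  obtain ⟨⟨x⟩, hx⟩ := hf (Quotient.mk _ (B.p b))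
  obtain ⟨γ⟩ : Joined (f x) (B.p b) := Quotient.exact hx
  obtain ⟨⟨b', hb'⟩, hb⟩ := (B.isCoveringMap.monodromy_bijective (.mk γ)).2 ⟨b, rfl⟩
  obtain ⟨⟨⟨x', a⟩, ha⟩, h⟩ := ht ⟨(x, b'), hb'.symm⟩
  have hab : t.map a = b' := congrArg (fun z : Function.Pullback f B.p => z.1.2) h
  subst hab
  have hp : A.p a = f x := (t.comm a).symm.trans hb'
  refine ⟨(A.isCoveringMap.monodromy (.mk γ) ⟨a, hp⟩).1, ?_⟩
  have h1 := types_congr_hom (((monodromy Y).map t).naturality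
    (FundamentalGroupoid.fromPath (.mk γ))) ⟨a, hp⟩
  exact (congrArg Subtype.val h1).trans (congrArg Subtype.val hb)

theorem surjective_p_of_pullback {f : C(X, Y)} (hf : Function.Surjective (pi0Map f)) (A : Cov Y)
    (hA : Function.Surjective (A.pullbackObj f).p) : Function.Surjective A.p := by
  intro y
  obtain ⟨⟨x⟩, hx⟩ := hf (Quotient.mk _ y)
  obtain ⟨γ⟩ : Joined (f x) y := Quotient.exact hx
  obtain ⟨⟨⟨x', a⟩, ha⟩, rfl⟩ := hA x
  let a' := A.isCoveringMap.monodromy (.mk γ) ⟨a, ha.symm⟩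
  exact ⟨a'.1, a'.2⟩

end Cov

variable {X Y : Type u} [TopologicalSpace X] [TopologicalSpace Y]

/-! ### The four categories of coverings -/

/-- An isomorphism of coverings between surjective coverings is one in `SCov X`. -/
def SCov.isoMk {A B : SCov X} (i : A.toCov ≅ B.toCov) : A ≅ B where
  hom := ⟨i.hom, Cov.surjective_iso_hom_map i⟩
  inv := ⟨i.inv, Cov.surjective_iso_hom_map i.symm⟩
  hom_inv_id := SCov.Hom.ext (congrArg Cov.Hom.map i.hom_inv_id)
  inv_hom_id := SCov.Hom.ext (congrArg Cov.Hom.map i.inv_hom_id)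

/-- An isomorphism of coverings that preserves basepoints is one in `BCov X x₀`. -/
def BCov.isoMk {x₀ : X} {A B : BCov X x₀} (i : A.toCov ≅ B.toCov)
    (h : i.hom.map A.base = B.base) : A ≅ B where
  hom := ⟨i.hom, h⟩
  inv := ⟨i.inv, by
    rw [← h]
    exact DFunLike.congr_fun (congrArg Cov.Hom.map i.hom_inv_id) A.base⟩
  hom_inv_id := BCov.Hom.ext (congrArg Cov.Hom.map i.hom_inv_id)
  inv_hom_id := BCov.Hom.ext (congrArg Cov.Hom.map i.inv_hom_id)

/-- An isomorphism of coverings between based surjective coverings that preserves basepoints is one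
in `BSCov X x₀`. -/
def BSCov.isoMk {x₀ : X} {A B : BSCov X x₀} (i : A.toCov ≅ B.toCov)
    (h : i.hom.map A.base = B.base) : A ≅ B where
  hom := ⟨⟨i.hom, h⟩, Cov.surjective_iso_hom_map i⟩
  inv := ⟨(BCov.isoMk (A := A.toBCov) (B := B.toBCov) i h).inv,
    Cov.surjective_iso_hom_map i.symm⟩
  hom_inv_id := BSCov.Hom.ext (congrArg Cov.Hom.map i.hom_inv_id)
  inv_hom_id := BSCov.Hom.ext (congrArg Cov.Hom.map i.inv_hom_id)

theorem SCov.isEquivalence_pullback (f : C(X, Y)) (hf : Function.Surjective (pi0Map f))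
    (h : (Cov.pullback f).IsEquivalence) : (SCov.pullback f).IsEquivalence where
  faithful := ⟨fun {A B} s t hst => SCov.Hom.ext (congrArg Cov.Hom.map
    ((Cov.pullback f).map_injective (congrArg SCov.Hom.toHom hst)))⟩
  full := ⟨fun {A B} s => by
    obtain ⟨t, ht⟩ := (Cov.pullback f).map_surjective (X := A.toCov) (Y := B.toCov) s.toHom
    refine ⟨⟨t, Cov.surjective_map_of_pullback hf t ?_⟩, SCov.Hom.ext (congrArg Cov.Hom.map ht)⟩
    rw [ht]
    exact s.surj⟩
  essSurj := ⟨fun C => by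
    let A := (Cov.pullback f).objPreimage C.toCov
    let i : A.pullbackObj f ≅ C.toCov := (Cov.pullback f).objObjPreimageIso C.toCov
    have hA : Function.Surjective A.p := Cov.surjective_p_of_pullback hf A fun x => by
      obtain ⟨c, hc⟩ := C.surj x
      exact ⟨i.inv.map c, (i.inv.comm c).trans hc⟩
    exact ⟨⟨A, hA⟩, ⟨SCov.isoMk i⟩⟩⟩

theorem BCov.isEquivalence_pullback (f : C(X, Y)) {x₀ : X} {y₀ : Y} (h₀ : f x₀ = y₀)
    (h : (Cov.pullback f).IsEquivalence) : (BCov.pullback f h₀).IsEquivalence where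
  faithful := ⟨fun {A B} s t hst => BCov.Hom.ext (congrArg Cov.Hom.map
    ((Cov.pullback f).map_injective (congrArg BCov.Hom.toHom hst)))⟩
  full := ⟨fun {A B} s => by
    obtain ⟨t, ht⟩ := (Cov.pullback f).map_surjective (X := A.toCov) (Y := B.toCov) s.toHom
    refine ⟨⟨t, ?_⟩, BCov.Hom.ext (congrArg Cov.Hom.map ht)⟩
    have h1 := s.map_base
    rw [← ht] at h1
    exact congrArg (fun z : Function.Pullback f B.p => z.1.2) h1⟩
  essSurj := ⟨fun C => by
    let A := (Cov.pullback f).objPreimage C.toCov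
    let i : A.pullbackObj f ≅ C.toCov := (Cov.pullback f).objObjPreimageIso C.toCov
    let z : Function.Pullback f A.p := i.inv.map C.base
    have hz : z.1.1 = x₀ := (i.inv.comm C.base).trans C.p_base
    refine ⟨⟨A, z.1.2, z.2.symm.trans ((congrArg f hz).trans h₀)⟩, ⟨BCov.isoMk i ?_⟩⟩
    have h1 : i.hom.map z = C.base :=
      DFunLike.congr_fun (congrArg Cov.Hom.map i.inv_hom_id) C.base
    have h2 : ∀ h, (⟨(x₀, z.1.2), h⟩ : Function.Pullback f A.p) = z := fun _ =>
      Subtype.ext (Prod.ext hz.symm rfl)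
    exact (congrArg i.hom.map (h2 _)).trans h1⟩

theorem BSCov.isEquivalence_pullback (f : C(X, Y)) {x₀ : X} {y₀ : Y} (h₀ : f x₀ = y₀)
    (hf : Function.Surjective (pi0Map f))
    (h : (BCov.pullback f h₀).IsEquivalence) : (BSCov.pullback f h₀).IsEquivalence where
  faithful := ⟨fun {A B} s t hst => BSCov.Hom.ext (congrArg (fun s => s.map)
    ((BCov.pullback f h₀).map_injective (congrArg BSCov.Hom.toBasedHom hst)))⟩
  full := ⟨fun {A B} s => by
    obtain ⟨t, ht⟩ := (BCov.pullback f h₀).map_surjective (X := A.toBCov) (Y := B.toBCov)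
      s.toBasedHom
    refine ⟨⟨t, Cov.surjective_map_of_pullback hf t.toHom ?_⟩,
      BSCov.Hom.ext (congrArg (fun s => s.map) ht)⟩
    have h1 : (Cov.pullback f).map t.toHom = s.toBasedHom.toHom := congrArg BCov.Hom.toHom ht
    rw [h1]
    exact s.surj⟩
  essSurj := ⟨fun C => by
    let A := (BCov.pullback f h₀).objPreimage C.toBCov
    let i : A.pullbackObj f h₀ ≅ C.toBCov := (BCov.pullback f h₀).objObjPreimageIso C.toBCov
    have hA : Function.Surjective A.p := Cov.surjective_p_of_pullback hf A.toCov fun x => by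
      obtain ⟨c, hc⟩ := C.surj x
      exact ⟨i.inv.map c, (i.inv.comm c).trans hc⟩
    let i' : A.toCov.pullbackObj f ≅ C.toCov :=
      { hom := i.hom.toHom
        inv := i.inv.toHom
        hom_inv_id := congrArg BCov.Hom.toHom i.hom_inv_id
        inv_hom_id := congrArg BCov.Hom.toHom i.inv_hom_id }
    exact ⟨⟨A, hA⟩, ⟨BSCov.isoMk i' i.hom.map_base⟩⟩⟩

section Converse

variable [LocallyPathConnectedSpace X] [LocallyPathConnectedSpace Y]
  (hX : SemilocallySimplyConnected X) (hY : SemilocallySimplyConnected Y) (f : C(X, Y))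

include hX hY

theorem Cov.isEquivalence_of_pullback (h : (Cov.pullback f).IsEquivalence) :
    (FundamentalGroupoid.map f).IsEquivalence :=
  Cov.isEquivalence_fundamentalGroupoid_map hX hY f
    (fun A _ _ _ _ _ ht =>
      (Cov.pullback f).map_injective (ht.trans ((Cov.pullback f).map_id A).symm))
    (fun A _ _ s _ _ => (Cov.pullback f).map_surjective (X := A) (Y := A) s)
    (fun C _ => ⟨_, ⟨(Cov.pullback f).objObjPreimageIso C⟩⟩)

theorem SCov.isEquivalence_of_pullback (h : (SCov.pullback f).IsEquivalence) :
    (FundamentalGroupoid.map f).IsEquivalence :=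
  Cov.isEquivalence_fundamentalGroupoid_map hX hY f
    (fun A σ hσ t hts _ ht => by
      let A' : SCov Y := ⟨A, fun y => ⟨σ y, hσ y⟩⟩
      let t' : A' ⟶ A' := ⟨t, hts⟩
      have h1 : (SCov.pullback f).map t' = (SCov.pullback f).map (𝟙 A') :=
        SCov.Hom.ext (congrArg Cov.Hom.map ht)
      exact congrArg SCov.Hom.toHom ((SCov.pullback f).map_injective h1))
    (fun A σ hσ s hs _ => by
      let A' : SCov Y := ⟨A, fun y => ⟨σ y, hσ y⟩⟩
      obtain ⟨t, ht⟩ := (SCov.pullback f).map_surjective (X := A') (Y := A') ⟨s, hs⟩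
      exact ⟨t.toHom, congrArg SCov.Hom.toHom ht⟩)
    (fun C hC => by
      let C' : SCov X := ⟨C, hC⟩
      let i := (SCov.pullback f).objObjPreimageIso C'
      exact ⟨((SCov.pullback f).objPreimage C').toCov,
        ⟨⟨i.hom.toHom, i.inv.toHom, congrArg SCov.Hom.toHom i.hom_inv_id,
          congrArg SCov.Hom.toHom i.inv_hom_id⟩⟩⟩)

theorem BCov.isEquivalence_of_pullback {x₀ : X} {y₀ : Y} (h₀ : f x₀ = y₀)
    (h : (BCov.pullback f h₀).IsEquivalence) :
    (FundamentalGroupoid.map f).IsEquivalence :=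
  Cov.isEquivalence_fundamentalGroupoid_map hX hY f
    (fun A σ hσ t _ htσ ht => by
      let A' : BCov Y y₀ := ⟨A, σ y₀, hσ y₀⟩
      let t' : A' ⟶ A' := ⟨t, htσ y₀⟩
      have h1 : (BCov.pullback f h₀).map t' = (BCov.pullback f h₀).map (𝟙 A') :=
        BCov.Hom.ext (congrArg Cov.Hom.map ht)
      exact congrArg BCov.Hom.toHom ((BCov.pullback f h₀).map_injective h1))
    (fun A σ hσ s _ hsσ => by
      subst h₀
      let A' : BCov Y (f x₀) := ⟨A, σ (f x₀), hσ (f x₀)⟩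
      obtain ⟨t, ht⟩ := (BCov.pullback f rfl).map_surjective (X := A') (Y := A') ⟨s, hsσ x₀⟩
      exact ⟨t.toHom, congrArg BCov.Hom.toHom ht⟩)
    (fun C hC => by
      obtain ⟨c, hc⟩ := hC x₀
      let C' : BCov X x₀ := ⟨C, c, hc⟩
      let i := (BCov.pullback f h₀).objObjPreimageIso C'
      exact ⟨((BCov.pullback f h₀).objPreimage C').toCov,
        ⟨⟨i.hom.toHom, i.inv.toHom, congrArg BCov.Hom.toHom i.hom_inv_id,
          congrArg BCov.Hom.toHom i.inv_hom_id⟩⟩⟩)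

theorem BSCov.isEquivalence_of_pullback {x₀ : X} {y₀ : Y} (h₀ : f x₀ = y₀)
    (h : (BSCov.pullback f h₀).IsEquivalence) :
    (FundamentalGroupoid.map f).IsEquivalence :=
  Cov.isEquivalence_fundamentalGroupoid_map hX hY f
    (fun A σ hσ t hts htσ ht => by
      let A' : BSCov Y y₀ := ⟨⟨A, σ y₀, hσ y₀⟩, fun y => ⟨σ y, hσ y⟩⟩
      let t' : A' ⟶ A' := ⟨⟨t, htσ y₀⟩, hts⟩
      have h1 : (BSCov.pullback f h₀).map t' = (BSCov.pullback f h₀).map (𝟙 A') :=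
        BSCov.Hom.ext (congrArg Cov.Hom.map ht)
      exact congrArg (fun s => s.toBasedHom.toHom) ((BSCov.pullback f h₀).map_injective h1))
    (fun A σ hσ s hs hsσ => by
      subst h₀
      let A' : BSCov Y (f x₀) := ⟨⟨A, σ (f x₀), hσ (f x₀)⟩, fun y => ⟨σ y, hσ y⟩⟩
      obtain ⟨t, ht⟩ := (BSCov.pullback f rfl).map_surjective (X := A') (Y := A')
        ⟨⟨s, hsσ x₀⟩, hs⟩
      exact ⟨t.toBasedHom.toHom, congrArg (fun s => s.toBasedHom.toHom) ht⟩)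
    (fun C hC => by
      obtain ⟨c, hc⟩ := hC x₀
      let C' : BSCov X x₀ := ⟨⟨C, c, hc⟩, hC⟩
      let i := (BSCov.pullback f h₀).objObjPreimageIso C'
      exact ⟨((BSCov.pullback f h₀).objPreimage C').toCov,
        ⟨⟨i.hom.toBasedHom.toHom, i.inv.toBasedHom.toHom,
          congrArg (fun s => s.toBasedHom.toHom) i.hom_inv_id,
          congrArg (fun s => s.toBasedHom.toHom) i.inv_hom_id⟩⟩⟩)

end Converse
theorem proposition3 {X Y : Type u} [TopologicalSpace X] [TopologicalSpace Y]
    [LocallyPathConnectedSpace X] [LocallyPathConnectedSpace Y]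
    (hX : SemilocallySimplyConnected X) (hY : SemilocallySimplyConnected Y) (f : C(X, Y)) :
    ((Function.Bijective (pi0Map f) ∧ ∀ x : X, Function.Bijective (FundamentalGroup.map f x)) ↔
      (Cov.pullback f).IsEquivalence) ∧
    ((Function.Bijective (pi0Map f) ∧ ∀ x : X, Function.Bijective (FundamentalGroup.map f x)) ↔
      (SCov.pullback f).IsEquivalence) ∧
    (∀ (x₀ : X) (y₀ : Y) (h : f x₀ = y₀),
      ((Function.Bijective (pi0Map f) ∧ ∀ x : X, Function.Bijective (FundamentalGroup.map f x)) ↔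
        (BCov.pullback f h).IsEquivalence)) ∧
    (∀ (x₀ : X) (y₀ : Y) (h : f x₀ = y₀),
      ((Function.Bijective (pi0Map f) ∧ ∀ x : X, Function.Bijective (FundamentalGroup.map f x)) ↔
        (BSCov.pullback f h).IsEquivalence)) := by
  rw [← FundamentalGroupoid.isEquivalence_map_iff]
  have hcov := Cov.isEquivalence_pullback hX hY f
  have hsurj (hf : (FundamentalGroupoid.map f).IsEquivalence) : Function.Surjective (pi0Map f) :=
    ((FundamentalGroupoid.isEquivalence_map_iff f).1 hf).1.2
  exact ⟨⟨hcov, Cov.isEquivalence_of_pullback hX hY f⟩,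
    ⟨fun hf => SCov.isEquivalence_pullback f (hsurj hf) (hcov hf),
      SCov.isEquivalence_of_pullback hX hY f⟩,
    fun x₀ y₀ h₀ => ⟨fun hf => BCov.isEquivalence_pullback f h₀ (hcov hf),
      BCov.isEquivalence_of_pullback hX hY f h₀⟩,
    fun x₀ y₀ h₀ => ⟨fun hf => BSCov.isEquivalence_pullback f h₀ (hsurj hf)
      (BCov.isEquivalence_pullback f h₀ (hcov hf)), BSCov.isEquivalence_of_pullback hX hY f h₀⟩⟩
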